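/- Let $\omega^\omega$ be the Baire space with the product topology. For a Polish space $X$ and a countable ordinal $\xi\geq 1$ let ${\bf\Sigma}^0_1(X)$ be the class of open subsets of $X$, let ${\bf\Pi}^0_\xi(X)$ be the class of complements of sets in ${\bf\Sigma}^0_\xi(X)$, and, for $\xi>1$, let ${\bf\Sigma}^0_\xi(X)$ be the class of countable unions of sets in $\bigcup_{1\leq\eta<\xi}{\bf\Pi}^0_\eta(X)$. Let ${\bf\Delta}^1_1(X)$ be the class of Borel subsets of $X$. For classes $\Gamma,\Gamma'$ of subsets of $X$, $Y$, let $(\Gamma\times\Gamma')_\sigma$ be the class of countable unions of rectangles $C\times D$ with $C\in\Gamma$ and $D\in\Gamma'$. **Theorem 1.1.** For each ordinal $1\leq\xi<\omega_1$ there is a partial map $f:\omega^\omega\to\omega^\omega$ such that the complement $\neg\mathrm{Gr}(f)=(\omega^\omega\times\omega^\omega)\setminus\mathrm{Gr}(f)$ of its graph is in ${\bf\Pi}^0_2(\omega^\omega\times\omega^\omega)$ and in $({\bf\Delta}^1_1\times{\bf\Sigma}^0_1)_\sigma$ (in particular, it is a countable union of Borel rectangles), but is not in $({\bf\Sigma}^0_\xi\times{\bf\Delta}^1_1)_\sigma$.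 Consequently, among subsets of $\omega^\omega\times\omega^\omega$: there is no map $r:\omega_1\setminus\{0\}\to\omega_1\setminus\{0\}$ with $${\bf\Pi}^0_\xi\cap({\bf\Delta}^1_1\times{\bf\Delta}^1_1)_\sigma\subseteq({\bf\Pi}^0_{r(\xi)}\times{\bf\Pi}^0_{r(\xi)})_\sigma\quad\text{for all }1\leq\xi<\omega_1,$$ and there is no map $s:\omega_1\setminus\{0\}\to\omega_1\setminus\{0\}$ with $${\bf\Pi}^0_\xi\cap({\bf\Delta}^1_1\times{\bf\Sigma}^0_1)_\sigma\subseteq({\bf\Pi}^0_{s(\xi)}\times{\bf\Sigma}^0_1)_\sigma\quad\text{for all }1\leq\xi<\omega_1.$$ -/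

import Mathlib

open scoped Ordinal

/-- The additive Borel classes `Σ⁰_ξ` of a topological space: `Σ⁰_1` consists of the open sets
and, for `ξ > 1`, `Σ⁰_ξ` consists of the countable unions of complements of sets that belong to
`Σ⁰_η` for some `1 ≤ η < ξ` (`η` may vary with the set). The class of index `0` is empty. -/
inductive IsSigmaZero {X : Type*} [TopologicalSpace X] : Ordinal.{0} → Set X → Prop
  | of_isOpen {U : Set X} (hU : IsOpen U) : IsSigmaZero 1 U
  | iUnion_compl {ξ : Ordinal.{0}} (hξ : 1 < ξ) (η : ℕ → Ordinal.{0}) (A : ℕ → Set X)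
      (hη : ∀ n, 1 ≤ η n ∧ η n < ξ) (hA : ∀ n, IsSigmaZero (η n) (A n)) :
      IsSigmaZero ξ (⋃ n, (A n)ᶜ)

/-- The class `Σ⁰_ξ` of subsets of `X`. -/
def SigmaZero (X : Type*) [TopologicalSpace X] (ξ : Ordinal.{0}) : Set (Set X) :=
  {A | IsSigmaZero ξ A}

/-- The class `Π⁰_ξ` of subsets of `X`: the complements of the `Σ⁰_ξ` sets. -/
def PiZero (X : Type*) [TopologicalSpace X] (ξ : Ordinal.{0}) : Set (Set X) :=
  {A | Aᶜ ∈ SigmaZero X ξ}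

/-- The class `Δ¹₁` of Borel subsets of `X`. -/
def BorelSets (X : Type*) [TopologicalSpace X] : Set (Set X) :=
  {A | @MeasurableSet X (borel X) A}

/-- The class `(Γ × Γ')_σ`: the countable unions of rectangles `C × D` with `C ∈ Γ`, `D ∈ Γ'`. -/
def RectSigma {X Y : Type*} (Γ : Set (Set X)) (Γ' : Set (Set Y)) : Set (Set (X × Y)) :=
  {A | ∃ (C : ℕ → Set X) (D : ℕ → Set Y),
    (∀ n, C n ∈ Γ) ∧ (∀ n, D n ∈ Γ') ∧ A = ⋃ n, C n ×ˢ D n}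

/-- The space `ω^ω`, with the product topology of the discrete topologies. -/
abbrev BaireSp : Type := ℕ → ℕ

/-! Label the nodes of countably many trees `ω^{<ω}` by the ordinals below `ω * ξ + 2`, and let the
code of a labelling record only where a child lies below its parent. If all labels occur below every
node, well-founded induction recovers the labelling from its code (`descentCode_injective`). The
partial map decodes those codes in which exactly one root carries `ω * ξ + 1` and the other roots `ω
* ξ`. Injectivity and Lusin–Souslin put the complement of the graph in the Borel-by-open class.

A `Σ⁰_ξ` set of codes cannot generically see whether a root carries `ω * ξ` or `ω * ξ + 1`: a
back-and-forth argument (`LabelSim.exists_extension`) spends `ω` ranks per Borel class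
(`IsSigmaZero.isMeagre_of_labelSim`). When no root is exceptional, the points (code, labelling)
avoid the graph, so some rectangle covers a non-meagre set of them. That set is comeagre in a
cylinder meeting finitely many trees; making the root of another tree exceptional yields a graph
point in the same rectangle. -/

/-! ### Similarity of ordinals -/

/-- Two ordinals are `θ`-similar if they are equal or both at least `θ`. -/
def OrdSim (θ a b : Ordinal.{0}) : Prop := a = b ∨ (θ ≤ a ∧ θ ≤ b)

theorem OrdSim.refl (θ a : Ordinal.{0}) : OrdSim θ a a := Or.inl rfl

theorem OrdSim.symm {θ a b : Ordinal.{0}} (h : OrdSim θ a b) : OrdSim θ b a :=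
  h.imp Eq.symm And.symm

theorem OrdSim.mono {θ θ' a b : Ordinal.{0}} (hθ : θ ≤ θ') (h : OrdSim θ' a b) : OrdSim θ a b :=
  h.imp id fun h => ⟨hθ.trans h.1, hθ.trans h.2⟩

/-- One step of the back-and-forth argument between similar ordinals. -/
theorem OrdSim.exists_step {θ a b : Ordinal.{0}} (h : OrdSim (θ + 1) a b) (c : Ordinal.{0}) :
    ∃ d, d ≤ max b c ∧ OrdSim θ c d ∧ (c < a ↔ d < b) := by
  rcases h with rfl | ⟨ha, hb⟩
  · exact ⟨c, le_max_right _ _, .refl _ _, Iff.rfl⟩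
  have hθ : θ < θ + 1 := Order.lt_add_one_iff.2 le_rfl
  have ha' := hθ.trans_le ha
  have hb' := hθ.trans_le hb
  -- Copy `c` below `θ`; otherwise answer `θ` or `b`, according to the side of `a` on which `c`
  -- lies.
  rcases lt_or_ge c θ with hc | hc
  · exact ⟨c, le_max_right _ _, .refl _ _, by simp [hc.trans ha', hc.trans hb']⟩
  rcases lt_or_ge c a with hca | hca
  · exact ⟨θ, hb'.le.trans (le_max_left _ _), Or.inr ⟨hc, le_rfl⟩, by simp [hca, hb']⟩
  · exact ⟨b, le_max_left _ _, Or.inr ⟨hc, hb'.le⟩, by simp [hca]⟩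

/-! ### Labelled forests and back-and-forth -/

/-- The non-root nodes of the forest `ω × ω^{<ω}`: the triple `(j, s, n)` is the child `n :: s` of
the node `s` of the `j`-th tree. -/
abbrev ForestNode : Type := ℕ × List ℕ × ℕ

/-- The labelling of the `j`-th tree with root label `z j` and with the labels `y` elsewhere. -/
def treeLabel (z : ℕ → ℕ) (y : ForestNode → ℕ) (j : ℕ) : List ℕ → ℕ
  | [] => z j
  | n :: s => y (j, s, n)

/-- A set of nodes closed under taking parents. -/
def IsParentClosed (S : Set ForestNode) : Prop :=
  ∀ j s m n, (j, m :: s, n) ∈ S → (j, s, m) ∈ S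

theorem IsParentClosed.union {S T : Set ForestNode} (hS : IsParentClosed S)
    (hT : IsParentClosed T) : IsParentClosed (S ∪ T) :=
  fun j s m n h => h.imp (hS j s m n) (hT j s m n)

theorem exists_finite_isParentClosed_mem (j : ℕ) (s : List ℕ) :
    ∀ n, ∃ S : Set ForestNode, S.Finite ∧ IsParentClosed S ∧ (j, s, n) ∈ S := by
  induction s with
  | nil =>
    intro n
    exact ⟨{(j, [], n)}, Set.finite_singleton _, fun j s m n h => by simp at h, rfl⟩
  | cons m s ih =>
    intro n
    obtain ⟨S, hf, hS, hm⟩ := ih m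
    refine ⟨insert (j, m :: s, n) S, hf.insert _, ?_, Set.mem_insert _ _⟩
    rintro j' s' m' n' (h | h)
    · simp only [Prod.mk.injEq, List.cons.injEq] at h
      obtain ⟨rfl, ⟨rfl, rfl⟩, rfl⟩ := h
      exact Set.mem_insert_of_mem _ hm
    · exact Set.mem_insert_of_mem _ (hS _ _ _ _ h)

theorem exists_finite_isParentClosed_superset (T : Finset ForestNode) :
    ∃ S : Set ForestNode, S.Finite ∧ IsParentClosed S ∧ (T : Set ForestNode) ⊆ S := by
  induction T using Finset.induction_on with
  | empty => exact ⟨∅, Set.finite_empty, fun _ _ _ _ h => h.elim, by simp⟩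
  | insert t T _ ih =>
    obtain ⟨S, hf, hS, hT⟩ := ih
    obtain ⟨j, s, n⟩ := t
    obtain ⟨S', hf', hS', hm⟩ := exists_finite_isParentClosed_mem j s n
    refine ⟨S' ∪ S, hf'.union hf, hS'.union hS, ?_⟩
    rw [Finset.coe_insert]
    exact Set.insert_subset (Or.inl hm) (hT.trans Set.subset_union_right)

theorem treeLabel_eq_of_eqOn {S : Set ForestNode} (hS : IsParentClosed S) (z : ℕ → ℕ)
    {y v : ForestNode → ℕ} (h : Set.EqOn v y S) {j : ℕ} {s : List ℕ} {n : ℕ}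
    (hn : (j, s, n) ∈ S) : treeLabel z v j s = treeLabel z y j s := by
  cases s with
  | nil => rfl
  | cons m s => exact h (hS _ _ _ _ hn)

/-- The labellings `(z, y)` and `(z', y')` have `θ`-similar ranks on the roots and on `S`, and the
same comparisons between nodes of `S` and their parents. -/
structure LabelSim (rk : ℕ → Ordinal.{0}) (θ : Ordinal.{0}) (S : Set ForestNode)
    (z : ℕ → ℕ) (y : ForestNode → ℕ) (z' : ℕ → ℕ) (y' : ForestNode → ℕ) : Prop where
  root : ∀ j, OrdSim θ (rk (z j)) (rk (z' j))
  node : ∀ t ∈ S, OrdSim θ (rk (y t)) (rk (y' t))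
  rel : ∀ t ∈ S,
    (rk (y t) < rk (treeLabel z y t.1 t.2.1) ↔ rk (y' t) < rk (treeLabel z' y' t.1 t.2.1))

theorem LabelSim.symm {rk : ℕ → Ordinal.{0}} {θ : Ordinal.{0}} {S : Set ForestNode}
    {z z' : ℕ → ℕ} {y y' : ForestNode → ℕ} (h : LabelSim rk θ S z y z' y') :
    LabelSim rk θ S z' y' z y :=
  ⟨fun j => (h.root j).symm, fun t ht => (h.node t ht).symm,
    fun t ht => (h.rel t ht).symm⟩

open Classical in
/-- The labels of a tree which agree with `y'` on `S` and follow the strategy `δ` elsewhere. -/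
noncomputable def strategyLabel (δ : ℕ → ℕ → ℕ → ℕ → ℕ) (S : Set ForestNode) (z z' : ℕ → ℕ)
    (v y' : ForestNode → ℕ) (j : ℕ) : List ℕ → ℕ
  | [] => z' j
  | n :: s => if (j, s, n) ∈ S then y' (j, s, n) else
      δ s.length (treeLabel z v j s) (strategyLabel δ S z z' v y' j s) (v (j, s, n))

/-- Back-and-forth extension: if `(z, y)` and `(z', y')` are similar on `S`, every labelling `v`
that agrees with `y` on `S` is matched by a labelling that agrees with `y'` on `S`. -/
theorem LabelSim.exists_extension {rk : ℕ → Ordinal.{0}} {κ : Ordinal.{0}}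
    (hrk : Set.range rk = Set.Iio κ) {θ θ' : Ordinal.{0}} (hθ : θ + ω ≤ θ')
    {S T : Set ForestNode} (hS : IsParentClosed S) (hT : T.Finite)
    {z z' : ℕ → ℕ} {y y' v : ForestNode → ℕ} (h : LabelSim rk θ' S z y z' y')
    (hv : Set.EqOn v y S) :
    ∃ v', Set.EqOn v' y' S ∧ LabelSim rk θ T z v z' v' := by
  obtain ⟨D, hD⟩ : ∃ D : ℕ, ∀ t ∈ T, t.2.1.length < D := by
    obtain ⟨D, hD⟩ := (hT.image fun t => t.2.1.length).bddAbove
    exact ⟨D + 1, fun t ht => Nat.lt_succ_of_le (hD ⟨t, ht, rfl⟩)⟩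
  -- Each level of depth costs one unit of similarity, so `ω` units suffice for every finite depth
  -- `D`.
  set ρ : ℕ → Ordinal.{0} := fun l => θ + ((D - l : ℕ) : Ordinal.{0}) with hρ
  have hρle : ∀ l, ρ l ≤ θ' := fun l =>
    (add_le_add_right (Ordinal.natCast_lt_omega0 _).le θ).trans hθ
  have hθρ : ∀ l, θ ≤ ρ l := fun l => le_add_of_nonneg_right zero_le
  have hstep : ∀ l a b c : ℕ, ∃ d, OrdSim (ρ (l + 1) + 1) (rk a) (rk b) →
      OrdSim (ρ (l + 1)) (rk c) (rk d) ∧ (rk c < rk a ↔ rk d < rk b) := by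
    intro l a b c
    by_cases hab : OrdSim (ρ (l + 1) + 1) (rk a) (rk b)
    · obtain ⟨d, hd, h1, h2⟩ := hab.exists_step (rk c)
      have hb : ∀ n, rk n < κ := fun n => by
        have : rk n ∈ Set.range rk := ⟨n, rfl⟩
        rwa [hrk] at this
      have : d ∈ Set.range rk := by
        rw [hrk]
        -- The bound by `max` keeps the answer in the initial segment enumerated by `rk`.
        exact hd.trans_lt (max_lt (hb b) (hb c))
      obtain ⟨d, rfl⟩ := this
      exact ⟨d, fun _ => ⟨h1, h2⟩⟩
    · exact ⟨0, fun h => (hab h).elim⟩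
  choose δ hδ using hstep
  set lab := strategyLabel δ S z z' v y'
  let v' : ForestNode → ℕ := fun t => lab t.1 (t.2.2 :: t.2.1)
  have hlab : ∀ j s, treeLabel z' v' j s = lab j s := by
    intro j s
    cases s <;> rfl
  have hv' : Set.EqOn v' y' S := fun t ht => if_pos ht
  have hsucc : ∀ l, l < D → ρ l = ρ (l + 1) + 1 := by
    intro l hl
    have : D - l = (D - (l + 1)) + 1 := by omega
    simp only [hρ]
    rw [this, Nat.cast_add, Nat.cast_one, add_assoc]
  have key : ∀ j s n, s.length < D → OrdSim (ρ s.length) (rk (treeLabel z v j s)) (rk (lab j s)) →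
      OrdSim (ρ (s.length + 1)) (rk (v (j, s, n))) (rk (v' (j, s, n))) ∧
      (rk (v (j, s, n)) < rk (treeLabel z v j s) ↔ rk (v' (j, s, n)) < rk (lab j s)) := by
    intro j s n hs hsim
    by_cases hn : (j, s, n) ∈ S
    · rw [← hlab, hv hn, hv' hn, treeLabel_eq_of_eqOn hS z hv hn,
        treeLabel_eq_of_eqOn hS z' hv' hn]
      exact ⟨(h.node _ hn).mono (hρle _), h.rel _ hn⟩
    · have : v' (j, s, n) = δ s.length (treeLabel z v j s) (lab j s) (v (j, s, n)) := if_neg hn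
      rw [this]
      exact hδ _ _ _ _ (hsucc _ hs ▸ hsim)
  have hsim : ∀ j s, s.length ≤ D → OrdSim (ρ s.length) (rk (treeLabel z v j s)) (rk (lab j s)) := by
    intro j s
    induction s with
    | nil => exact fun _ => (h.root j).mono (hρle _)
    | cons n s ih =>
      intro hs
      have hs' : s.length < D := hs
      exact (key j s n hs' (ih hs'.le)).1
  refine ⟨v', hv', fun j => (h.root j).mono ((hθρ 0).trans (hρle 0)), ?_, ?_⟩
  · rintro ⟨j, s, n⟩ ht
    exact (key j s n (hD _ ht) (hsim _ _ (hD _ ht).le)).1.mono (hθρ _)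
  · rintro ⟨j, s, n⟩ ht
    rw [hlab]
    exact (key j s n (hD _ ht) (hsim _ _ (hD _ ht).le)).2

/-! ### Category in cylinders, and codes -/

theorem isOpen_eqOn {ι : Type*} {S : Set ι} (hS : S.Finite) (v : ι → ℕ) :
    IsOpen {u : ι → ℕ | Set.EqOn u v S} := by
  have : {u : ι → ℕ | Set.EqOn u v S} = ⋂ i ∈ S, {u | u i = v i} := by
    ext u
    simp [Set.EqOn]
  rw [this]
  exact hS.isOpen_biInter fun i _ =>
    (isOpen_discrete ({v i} : Set ℕ)).preimage (continuous_apply (A := fun _ : ι => ℕ) i)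

theorem exists_finset_eqOn_subset {ι : Type*} {W : Set (ι → ℕ)} (hW : IsOpen W) {v : ι → ℕ}
    (hv : v ∈ W) : ∃ I : Finset ι, ∀ u : ι → ℕ, Set.EqOn u v I → u ∈ W := by
  obtain ⟨I, U, hU, hIU⟩ := isOpen_pi_iff.1 hW v hv
  exact ⟨I, fun u hu => hIU fun i hi => by rw [hu hi]; exact (hU i hi).2⟩

/-- A Baire measurable set that is not meagre is comeagre in a cylinder over a parent closed set. -/
theorem BaireMeasurableSet.exists_isMeagre_cylinder_diff {A : Set (ForestNode → ℕ)}
    (hA : BaireMeasurableSet A) {S : Set ForestNode} (hSf : S.Finite) (hS : IsParentClosed S)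
    {y : ForestNode → ℕ} (h : ¬ IsMeagre (A ∩ {v | Set.EqOn v y S})) :
    ∃ (v : ForestNode → ℕ) (T : Set ForestNode), Set.EqOn v y S ∧ S ⊆ T ∧ T.Finite ∧
      IsParentClosed T ∧ IsMeagre ({u | Set.EqOn u v T} \ A) := by
  set N := {v : ForestNode → ℕ | Set.EqOn v y S} with hN
  have hNo : IsOpen N := isOpen_eqOn hSf y
  obtain ⟨W, hWo, hAW⟩ := hA.residualEq_isOpen
  have hne : (W ∩ N).Nonempty := by
    by_contra hemp
    rw [Set.not_nonempty_iff_eq_empty] at hemp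
    refine h ?_
    change _ ∈ residual _
    filter_upwards [hAW] with u hu hu'
    have : u ∈ W ∩ N := ⟨(iff_of_eq hu).1 hu'.1, hu'.2⟩
    rw [hemp] at this
    exact this
  obtain ⟨v, hvW, hvN⟩ := hne
  obtain ⟨I, hI⟩ := exists_finset_eqOn_subset hWo hvW
  obtain ⟨T, hTf, hT, hIT⟩ := exists_finite_isParentClosed_superset I
  refine ⟨v, S ∪ T, hvN, Set.subset_union_left, hSf.union hTf, hS.union hT, ?_⟩
  change _ ∈ residual _
  filter_upwards [hAW] with u hu hu'
  exact hu'.2 ((iff_of_eq hu).2 (hI u (hu'.1.mono (hIT.trans Set.subset_union_right))))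

/-- An enumeration of the nodes of the forest. -/
def forestNodeEquiv : ℕ ≃ ForestNode := (Denumerable.eqv ForestNode).symm

open Classical in
/-- The real that records which nodes have a label of smaller rank than their parent. -/
noncomputable def descentCode (rk : ℕ → Ordinal.{0}) (z : ℕ → ℕ) (y : ForestNode → ℕ) : BaireSp :=
  fun i => if rk (y (forestNodeEquiv i)) <
    rk (treeLabel z y (forestNodeEquiv i).1 (forestNodeEquiv i).2.1) then 1 else 0

theorem continuous_treeLabel (z : ℕ → ℕ) (j : ℕ) (s : List ℕ) :
    Continuous fun y => treeLabel z y j s := by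
  cases s with
  | nil => exact continuous_const
  | cons n s => exact continuous_apply _

theorem continuous_descentCode (rk : ℕ → Ordinal.{0}) (z : ℕ → ℕ) :
    Continuous (descentCode rk z) := by
  classical
  refine continuous_pi fun i => ?_
  have h : Continuous fun p : ℕ × ℕ => if rk p.1 < rk p.2 then 1 else 0 :=
    continuous_of_discreteTopology
  exact h.comp ((continuous_apply (forestNodeEquiv i)).prodMk (continuous_treeLabel z _ _))

theorem IsSigmaZero.measurableSet_borel {X : Type*} [TopologicalSpace X] {ξ : Ordinal.{0}} {A : Set X}
    (h : IsSigmaZero ξ A) : @MeasurableSet X (borel X) A := by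
  let := borel X
  have : BorelSpace X := ⟨rfl⟩
  induction h with
  | of_isOpen hU => exact hU.measurableSet
  | iUnion_compl _ _ _ _ _ ih => exact MeasurableSet.iUnion fun n => (ih n).compl

theorem IsSigmaZero.baireMeasurableSet_descentCode {ξ : Ordinal.{0}} {C : Set BaireSp}
    (h : IsSigmaZero ξ C) (rk : ℕ → Ordinal.{0}) (z : ℕ → ℕ) :
    BaireMeasurableSet {v | descentCode rk z v ∈ C} := by
  let := borel BaireSp
  have : BorelSpace BaireSp := ⟨rfl⟩
  exact ((continuous_descentCode rk z).measurable h.measurableSet_borel).baireMeasurableSet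

/-- `Σ⁰_ξ` sets of codes cannot generically separate labellings that are similar of rank `ω * ξ`. -/
theorem IsSigmaZero.isMeagre_of_labelSim {rk : ℕ → Ordinal.{0}} {κ : Ordinal.{0}}
    (hrk : Set.range rk = Set.Iio κ) {ξ : Ordinal.{0}} {C : Set BaireSp} (hC : IsSigmaZero ξ C) :
    ∀ {S : Set ForestNode} (_ : S.Finite) (_ : IsParentClosed S) {z z' : ℕ → ℕ}
      {y y' : ForestNode → ℕ} (_ : LabelSim rk (ω * ξ) S z y z' y'),
      IsMeagre ({v | descentCode rk z v ∈ C} ∩ {v | Set.EqOn v y S}) →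
      IsMeagre ({v | descentCode rk z' v ∈ C} ∩ {v | Set.EqOn v y' S}) := by
  -- Passing from `η` to `ξ` frees the `ω` ranks that one extension consumes.
  have hmul : ∀ {η ξ : Ordinal.{0}}, η < ξ → ω * η + ω ≤ ω * ξ := fun {η ξ} h => by
    rw [← mul_add_one]
    exact mul_le_mul_right (Order.add_one_le_of_lt h) _
  induction hC with
  | @of_isOpen U hU =>
    intro S hSf hS z z' y y' h hm
    by_contra hm'
    obtain ⟨v', hv'U, hv'⟩ := nonempty_of_not_isMeagre hm'
    obtain ⟨I, hI⟩ := exists_finset_eqOn_subset hU hv'U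
    obtain ⟨T, hTf, -, hIT⟩ :=
      exists_finite_isParentClosed_superset (I.image forestNodeEquiv)
    obtain ⟨v, hv, hsim⟩ := h.symm.exists_extension hrk (θ := 0)
      (by rw [← mul_zero ω]; exact hmul zero_lt_one) hS hTf hv'
    refine not_isMeagre_of_isOpen
      ((hU.preimage (continuous_descentCode rk z)).inter (isOpen_eqOn hSf y))
      ⟨v, hI _ fun i hi => ?_, hv⟩ hm
    have hiT : forestNodeEquiv i ∈ T := hIT (by
      rw [Finset.coe_image]
      exact ⟨i, hi, rfl⟩)
    simp only [descentCode]
    exact if_congr (hsim.rel _ hiT).symm rfl rfl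
  | @iUnion_compl ξ hξ η A hη hA ih =>
    intro S hSf hS z z' y y' h hm
    by_contra hm'
    obtain ⟨n, hn⟩ : ∃ n, ¬ IsMeagre ({v | descentCode rk z' v ∈ (A n)ᶜ} ∩
        {v | Set.EqOn v y' S}) := by
      by_contra! hcon
      refine hm' ((isMeagre_iUnion hcon).mono ?_)
      rintro v ⟨hv, hvS⟩
      obtain ⟨n, hn⟩ := Set.mem_iUnion.1 hv
      exact Set.mem_iUnion.2 ⟨n, hn, hvS⟩
    obtain ⟨v', T, hv', hST, hTf, hT, hmT⟩ :=
      ((hA n).baireMeasurableSet_descentCode rk z').compl.exists_isMeagre_cylinder_diff hSf hS hn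
    obtain ⟨v, hv, hsim⟩ := h.symm.exists_extension hrk (hmul (hη n).2) hS hTf hv'
    -- Induction makes `A n` meagre on the cylinder of `v`, while `hm` makes its complement meagre
    -- there: a contradiction with Baire's theorem.
    have h1 := ih n hTf hT hsim (hmT.mono (by rintro u ⟨hu, hu'⟩; exact ⟨hu', fun h => h hu⟩))
    refine not_isMeagre_of_isOpen (isOpen_eqOn hTf v) ⟨v, fun _ _ => rfl⟩
      ((h1.union hm).mono fun u hu => ?_)
    by_cases hu' : descentCode rk z u ∈ A n
    · exact Or.inl ⟨hu', hu⟩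
    · exact Or.inr ⟨Set.mem_iUnion.2 ⟨n, hu'⟩, (hu.mono hST).trans hv⟩

/-! ### Full labellings and decoding -/

/-- The labellings for which every label occurs among the children of every node. -/
def FullLabelling : Set (ForestNode → ℕ) := {y | ∀ j s m, ∃ n, y (j, s, n) = m}

theorem fullLabelling_mem_residual : FullLabelling ∈ residual (ForestNode → ℕ) := by
  have h : FullLabelling = ⋂ t : ForestNode, {y | ∃ n, y (t.1, t.2.1, n) = t.2.2} := by
    ext y
    simp [FullLabelling]
  rw [h]
  refine countable_iInter_mem.2 fun ⟨j, s, m⟩ => residual_of_dense_open ?_ ?_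
  · simp only [Set.ofPred_exists]
    exact isOpen_iUnion fun n => (isOpen_discrete ({m} : Set ℕ)).preimage
      (continuous_apply (A := fun _ : ForestNode => ℕ) (j, s, n))
  · intro y
    -- Writing `m` at ever later children changes each fixed coordinate at most once.
    refine mem_closure_of_tendsto (f := fun n : ℕ => Function.update y (j, s, n) m)
      (b := Filter.atTop) (tendsto_pi_nhds.2 fun t => ?_)
      (Filter.Eventually.of_forall fun n => ⟨n, by simp⟩)
    refine tendsto_const_nhds.congr' ?_
    filter_upwards [Filter.eventually_gt_atTop t.2.2] with n hn
    rw [Function.update_of_ne]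
    rintro rfl
    exact lt_irrefl _ hn

/-- The code of a full labelling determines all labels. -/
theorem descentCode_injective {rk : ℕ → Ordinal.{0}} (hinj : Function.Injective rk)
    {z z' : ℕ → ℕ} {y y' : ForestNode → ℕ} (hy : y ∈ FullLabelling) (hy' : y' ∈ FullLabelling)
    (h : descentCode rk z y = descentCode rk z' y') : z = z' ∧ y = y' := by
  have hrel : ∀ t : ForestNode, rk (y t) < rk (treeLabel z y t.1 t.2.1) ↔
      rk (y' t) < rk (treeLabel z' y' t.1 t.2.1) := by
    intro t
    have := congrFun h (forestNodeEquiv.symm t)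
    simp only [descentCode, Equiv.apply_symm_apply] at this
    by_cases h1 : rk (y t) < rk (treeLabel z y t.1 t.2.1) <;>
      by_cases h2 : rk (y' t) < rk (treeLabel z' y' t.1 t.2.1)
    · exact iff_of_true h1 h2
    · rw [if_pos h1, if_neg h2] at this
      exact absurd this one_ne_zero
    · rw [if_neg h1, if_pos h2] at this
      exact absurd this zero_ne_one
    · exact iff_of_false h1 h2
  have key : ∀ a : ℕ, ∀ j s, treeLabel z y j s = a → treeLabel z' y' j s = a := by
    intro a
    induction a using (InvImage.wf rk wellFounded_lt).induction with
    | h a ih =>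
    intro j s hs
    refine hinj (le_antisymm ?_ ?_)
    -- In `y'` a child labelled `a` descends, so its label in `y` ranks below `a`; by induction both
    -- labels agree, which is absurd.
    · by_contra! hlt
      obtain ⟨n, hn⟩ := hy' j s a
      have h1 := (hrel (j, s, n)).2 (by simpa only [hn] using hlt)
      have h2 : y' (j, s, n) = y (j, s, n) := ih (y (j, s, n)) (hs ▸ h1) j (n :: s) rfl
      rw [← h2, hn, hs] at h1
      exact lt_irrefl _ h1
    · by_contra! hlt
      obtain ⟨n, hn⟩ := hy j s (treeLabel z' y' j s)
      have h1 := (hrel (j, s, n)).1 (by simpa only [hn, hs] using hlt)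
      have h2 : y' (j, s, n) = treeLabel z' y' j s := ih _ hlt j (n :: s) hn
      rw [h2] at h1
      exact lt_irrefl _ h1
  exact ⟨funext fun j => (key _ j [] rfl).symm,
    funext fun t => (key _ t.1 (t.2.2 :: t.2.1) rfl).symm⟩

/-- The coordinates of a real that codes a labelling together with witnesses for its fullness. -/
def witnessedEquiv : ℕ ≃ ForestNode ⊕ ForestNode :=
  (Denumerable.eqv (ForestNode ⊕ ForestNode)).symm

/-- The labelling coded by a real. -/
def labelPart (u : BaireSp) : ForestNode → ℕ := fun t => u (witnessedEquiv.symm (.inl t))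

/-- The witnesses coded by a real. -/
def witnessPart (u : BaireSp) : ForestNode → ℕ := fun t => u (witnessedEquiv.symm (.inr t))

/-- The reals coding a full labelling together with the least witnesses. -/
def WitnessedSet : Set BaireSp :=
  {u | ∀ j s m n, (witnessPart u (j, s, m) = n → labelPart u (j, s, n) = m) ∧
    (labelPart u (j, s, n) = m → witnessPart u (j, s, m) ≤ n)}

theorem continuous_labelPart : Continuous labelPart :=
  continuous_pi fun _ => continuous_apply _

theorem continuous_witnessPart : Continuous witnessPart :=
  continuous_pi fun _ => continuous_apply _

/-- Fullness alone is a `G_δ` condition; storing least witnesses makes it closed, hence the graph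
`F_σ`, without losing injectivity. -/
theorem isClosed_witnessedSet : IsClosed WitnessedSet := by
  simp only [WitnessedSet, Set.ofPred_forall]
  refine isClosed_iInter fun j => isClosed_iInter fun s => isClosed_iInter fun m =>
    isClosed_iInter fun n => ?_
  exact (isClosed_discrete {p : ℕ × ℕ | (p.1 = n → p.2 = m) ∧ (p.2 = m → p.1 ≤ n)}).preimage
    (((continuous_apply (j, s, m)).comp continuous_witnessPart).prodMk
      ((continuous_apply (j, s, n)).comp continuous_labelPart))

theorem labelPart_mem_fullLabelling {u : BaireSp} (hu : u ∈ WitnessedSet) :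
    labelPart u ∈ FullLabelling := fun j s m => ⟨_, (hu j s m _).1 rfl⟩

theorem injOn_labelPart : Set.InjOn labelPart WitnessedSet := by
  intro u hu u' hu' h
  have hw : witnessPart u = witnessPart u' := by
    funext ⟨j, s, m⟩
    refine le_antisymm ((hu j s m _).2 ?_) ((hu' j s m _).2 ?_)
    · rw [h]
      exact (hu' j s m _).1 rfl
    · rw [← h]
      exact (hu j s m _).1 rfl
  funext i
  rcases hi : witnessedEquiv i with t | t
  · rw [← witnessedEquiv.symm_apply_apply i, hi]
    exact congrFun h t
  · rw [← witnessedEquiv.symm_apply_apply i, hi]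
    exact congrFun hw t

theorem exists_labelPart_eq {y : ForestNode → ℕ} (hy : y ∈ FullLabelling) :
    ∃ u ∈ WitnessedSet, labelPart u = y := by
  let u : BaireSp := fun i =>
    Sum.elim y (fun t => sInf {n | y (t.1, t.2.1, n) = t.2.2}) (witnessedEquiv i)
  have hl : labelPart u = y := by
    funext t
    simp [labelPart, u]
  have hw : ∀ j s m, witnessPart u (j, s, m) = sInf {n | y (j, s, n) = m} := fun j s m => by
    simp [witnessPart, u]
  refine ⟨u, fun j s m n => ?_, hl⟩
  rw [hw, hl]
  refine ⟨?_, fun h => Nat.sInf_le h⟩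
  rintro rfl
  exact Nat.sInf_mem (s := {n | y (j, s, n) = m}) (hy j s m)

/-! ### The graph and its complement -/

theorem exists_pfun_graph_eq {α β : Type*} {G : Set (α × β)}
    (hG : ∀ a b b', (a, b) ∈ G → (a, b') ∈ G → b = b') : ∃ f : α →. β, f.graph = G := by
  classical
  refine ⟨fun a => ⟨∃ b, (a, b) ∈ G, fun h => h.choose⟩, ?_⟩
  ext ⟨a, b⟩
  constructor
  · rintro ⟨h, hb⟩
    have hc : (a, h.choose) ∈ G := h.choose_spec
    rwa [show h.choose = b from hb] at hc
  · intro h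
    exact ⟨⟨b, h⟩, hG _ _ _ (Exists.choose_spec (p := fun b => (a, b) ∈ G) _) h⟩

/-- Root labels equal to `a` except for the `k`-th root, which has label `b`. -/
def rootLabel (a b k : ℕ) : ℕ → ℕ := Function.update (fun _ => a) k b

/-- The graph of the partial map that recovers a witnessed full labelling from its code, for the
codes in which exactly one root has label `b` instead of `a`. -/
def decodingGraph (rk : ℕ → Ordinal.{0}) (a b : ℕ) : Set (BaireSp × BaireSp) :=
  ⋃ k, {p | p.2 ∈ WitnessedSet ∧ descentCode rk (rootLabel a b k) (labelPart p.2) = p.1}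

theorem mem_decodingGraph {rk : ℕ → Ordinal.{0}} {a b : ℕ} {x u : BaireSp} :
    (x, u) ∈ decodingGraph rk a b ↔
      ∃ k, u ∈ WitnessedSet ∧ descentCode rk (rootLabel a b k) (labelPart u) = x := by
  simp [decodingGraph]

theorem decodingGraph_unique {rk : ℕ → Ordinal.{0}} (hinj : Function.Injective rk) {a b : ℕ}
    {x u u' : BaireSp} (h : (x, u) ∈ decodingGraph rk a b) (h' : (x, u') ∈ decodingGraph rk a b) :
    u = u' := by
  obtain ⟨k, hu, hx⟩ := mem_decodingGraph.1 h
  obtain ⟨k', hu', hx'⟩ := mem_decodingGraph.1 h'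
  exact injOn_labelPart hu hu' (descentCode_injective hinj (labelPart_mem_fullLabelling hu)
    (labelPart_mem_fullLabelling hu') (hx.trans hx'.symm)).2

theorem decodingGraph_compl_mem_piZero (rk : ℕ → Ordinal.{0}) (a b : ℕ) :
    (decodingGraph rk a b)ᶜ ∈ PiZero (BaireSp × BaireSp) 2 := by
  have h := IsSigmaZero.iUnion_compl (X := BaireSp × BaireSp) (ξ := 2) one_lt_two (fun _ => 1)
    (fun k => {p | p.2 ∈ WitnessedSet ∧ descentCode rk (rootLabel a b k) (labelPart p.2) = p.1}ᶜ)
    (fun _ => ⟨le_rfl, one_lt_two⟩) (fun k => .of_isOpen (IsClosed.isOpen_compl (self := ?_)))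
  · simp only [compl_compl] at h
    change IsSigmaZero 2 _
    rwa [compl_compl]
  · exact (isClosed_witnessedSet.preimage continuous_snd).inter (isClosed_eq
      ((continuous_descentCode rk _).comp (continuous_labelPart.comp continuous_snd))
      continuous_fst)

/-- For each `k` this is an injective continuous image of a Borel set, so Lusin–Souslin applies. -/
theorem measurableSet_decodingGraph_image {rk : ℕ → Ordinal.{0}} (hinj : Function.Injective rk)
    (a b : ℕ) {N : Set BaireSp} (hN : IsOpen N) :
    MeasurableSet {x | ∃ u ∈ N, (x, u) ∈ decodingGraph rk a b} := by
  have h : {x | ∃ u ∈ N, (x, u) ∈ decodingGraph rk a b} =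
      ⋃ k, (fun u => descentCode rk (rootLabel a b k) (labelPart u)) '' (WitnessedSet ∩ N) := by
    ext x
    simp only [mem_decodingGraph, Set.mem_iUnion, Set.mem_image, Set.mem_inter_iff]
    exact ⟨fun ⟨u, hN, k, hu, hx⟩ => ⟨k, u, ⟨hu, hN⟩, hx⟩,
      fun ⟨k, u, ⟨hu, hN⟩, hx⟩ => ⟨u, hN, k, hu, hx⟩⟩
  rw [h]
  refine MeasurableSet.iUnion fun k =>
    (isClosed_witnessedSet.measurableSet.inter hN.measurableSet).image_of_continuousOn_injOn
      ((continuous_descentCode rk _).comp continuous_labelPart).continuousOn ?_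
  intro u hu u' hu' h
  exact injOn_labelPart hu.1 hu'.1 (descentCode_injective hinj (labelPart_mem_fullLabelling hu.1)
    (labelPart_mem_fullLabelling hu'.1) h).2

theorem borelSets_iff {A : Set BaireSp} : A ∈ BorelSets BaireSp ↔ MeasurableSet A := by
  rw [BorelSpace.measurable_eq (α := BaireSp)]
  rfl

/-- Sections over `x` have at most one point, so a basic open set around `u` separates `u` from it.
-/
theorem decodingGraph_compl_mem_rectSigma {rk : ℕ → Ordinal.{0}} (hinj : Function.Injective rk)
    (a b : ℕ) :
    (decodingGraph rk a b)ᶜ ∈ RectSigma (BorelSets BaireSp) (SigmaZero BaireSp 1) := by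
  obtain ⟨B, hBc, -, hB⟩ := TopologicalSpace.exists_countable_basis BaireSp
  have hne : B.Nonempty := by
    obtain ⟨N, hN, -⟩ := hB.exists_subset_of_mem_open (Set.mem_univ (0 : BaireSp)) isOpen_univ
    exact ⟨N, hN⟩
  obtain ⟨N, rfl⟩ := hBc.exists_eq_range hne
  have hNo : ∀ n, IsOpen (N n) := fun n => hB.isOpen ⟨n, rfl⟩
  refine ⟨fun n => {x | ∃ u ∈ N n, (x, u) ∈ decodingGraph rk a b}ᶜ, N,
    fun n => borelSets_iff.2 (measurableSet_decodingGraph_image hinj a b (hNo n)).compl,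
    fun n => .of_isOpen (hNo n), ?_⟩
  ext ⟨x, u⟩
  simp only [Set.mem_iUnion, Set.mem_prod, Set.mem_compl_iff, Set.mem_ofPred_eq]
  refine ⟨fun h => ?_, fun ⟨n, hx, hu⟩ h => hx ⟨u, hu, h⟩⟩
  by_cases hx : ∃ u', (x, u') ∈ decodingGraph rk a b
  · obtain ⟨u', hu'⟩ := hx
    have hne : u ≠ u' := fun e => h (e ▸ hu')
    obtain ⟨_, ⟨n, rfl⟩, hu, hn⟩ :=
      hB.exists_subset_of_mem_open (a := u) (Set.mem_compl_singleton_iff.2 hne)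
        isOpen_compl_singleton
    exact ⟨n, fun ⟨v, hv, hxv⟩ => hn hv (decodingGraph_unique hinj hxv hu'), hu⟩
  · obtain ⟨_, ⟨n, rfl⟩, hu, -⟩ := hB.exists_subset_of_mem_open (Set.mem_univ u) isOpen_univ
    exact ⟨n, fun ⟨v, _, hxv⟩ => hx ⟨v, hxv⟩, hu⟩

theorem decodingGraph_compl_notMem_rectSigma {rk : ℕ → Ordinal.{0}} (hinj : Function.Injective rk)
    {κ : Ordinal.{0}} (hrk : Set.range rk = Set.Iio κ) {ξ : Ordinal.{0}} {a b : ℕ} (hab : a ≠ b)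
    (ha : ω * ξ ≤ rk a) (hb : ω * ξ ≤ rk b) :
    (decodingGraph rk a b)ᶜ ∉ RectSigma (SigmaZero BaireSp ξ) (BorelSets BaireSp) := by
  rintro ⟨C, D, hC, hD, hCD⟩
  set z : ℕ → ℕ := fun _ => a
  have hzk : ∀ k, z ≠ rootLabel a b k := fun k h => hab (by
    simpa [z, rootLabel] using congrFun h k)
  set E : ℕ → Set (ForestNode → ℕ) := fun n => labelPart '' (WitnessedSet ∩ D n)
  have hE : ∀ n, MeasurableSet (E n) := fun n =>
    (isClosed_witnessedSet.measurableSet.inter (borelSets_iff.1 (hD n))).image_of_continuousOn_injOn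
      continuous_labelPart.continuousOn (injOn_labelPart.mono Set.inter_subset_left)
  have hcover : FullLabelling ⊆ ⋃ n, {v | descentCode rk z v ∈ C n} ∩ E n := by
    intro y hy
    obtain ⟨u, hu, rfl⟩ := exists_labelPart_eq hy
    have hmem : (descentCode rk z (labelPart u), u) ∈ (decodingGraph rk a b)ᶜ := by
      intro h
      obtain ⟨k, -, hx⟩ := mem_decodingGraph.1 h
      exact hzk k (descentCode_injective hinj hy hy hx.symm).1
    rw [hCD] at hmem
    obtain ⟨n, h1, h2⟩ := Set.mem_iUnion.1 hmem
    exact Set.mem_iUnion.2 ⟨n, h1, u, ⟨hu, h2⟩, rfl⟩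
  obtain ⟨n, hn⟩ : ∃ n, ¬ IsMeagre ({v | descentCode rk z v ∈ C n} ∩ E n) := by
    by_contra! hcon
    refine not_isMeagre_of_isOpen (isOpen_univ (X := ForestNode → ℕ)) ⟨z 0, trivial⟩ ?_
    have h1 : IsMeagre (FullLabellingᶜ) := by
      change _ ∈ residual _
      rw [compl_compl]
      exact fullLabelling_mem_residual
    refine (h1.union (isMeagre_iUnion hcon)).mono fun y _ => ?_
    by_cases hy : y ∈ FullLabelling
    · exact Or.inr (hcover hy)
    · exact Or.inl hy
  obtain ⟨v, S, -, -, hSf, hS, hm⟩ :=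
    (((hC n).baireMeasurableSet_descentCode rk z).inter
      (hE n).baireMeasurableSet).exists_isMeagre_cylinder_diff (S := ∅) (y := fun _ => 0)
      Set.finite_empty (fun _ _ _ _ h => h.elim)
      (by simpa only [Set.eqOn_empty, Set.ofPred_true, Set.inter_univ] using hn)
  -- No comparison recorded on `S` involves the root of a tree that `S` misses.
  obtain ⟨k, hk⟩ : ∃ k, ∀ t ∈ S, t.1 ≠ k := by
    obtain ⟨k, hk⟩ := (hSf.image Prod.fst).exists_notMem
    exact ⟨k, fun t ht e => hk ⟨t, ht, e⟩⟩
  have hsim : LabelSim rk (ω * ξ) S (rootLabel a b k) v z v := by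
    refine ⟨fun j => ?_, fun t _ => .refl _ _, fun ⟨j, s, n⟩ ht => ?_⟩
    · by_cases hj : j = k
      · subst hj
        exact Or.inr ⟨by simpa [rootLabel] using hb, ha⟩
      · exact Or.inl (by simp [rootLabel, hj, z])
    · cases s with
      | nil =>
        have : rootLabel a b k j = z j := Function.update_of_ne (hk _ ht) _ _
        simp only [treeLabel, this]
      | cons m s => rfl
  have hopen := isOpen_eqOn hSf v
  have hne : ({u | descentCode rk (rootLabel a b k) u ∈ C n} ∩ E n).Nonempty := by
    by_contra hemp
    rw [Set.not_nonempty_iff_eq_empty] at hemp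
    -- If the modified codes missed the rectangle, meagreness would transfer back to the original
    -- codes, which are generically in `C n`.
    have hm' := (hC n).isMeagre_of_labelSim hrk hSf hS hsim (hm.mono ?_)
    · refine not_isMeagre_of_isOpen hopen ⟨v, fun _ _ => rfl⟩ ((hm.union hm').mono fun u hu => ?_)
      by_cases hu' : descentCode rk z u ∈ C n
      · exact Or.inr ⟨hu', hu⟩
      · exact Or.inl ⟨hu, fun h => hu' h.1⟩
    · rintro u ⟨hu, huS⟩
      refine ⟨huS, fun h => ?_⟩
      have : u ∈ ({u | descentCode rk (rootLabel a b k) u ∈ C n} ∩ E n) := ⟨hu, h.2⟩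
      rw [hemp] at this
      exact this
  obtain ⟨_, hx, u, ⟨hu, huD⟩, rfl⟩ := hne
  have : (descentCode rk (rootLabel a b k) (labelPart u), u) ∈ (decodingGraph rk a b)ᶜ := by
    rw [hCD]
    exact Set.mem_iUnion.2 ⟨n, hx, huD⟩
  exact this (mem_decodingGraph.2 ⟨k, hu, rfl⟩)

/-! ### Choice of labels and the consequences -/

theorem lt_omega_one_iff_card_le {o : Ordinal.{0}} : o < ω₁ ↔ o.card ≤ Cardinal.aleph0 := by
  rw [← Cardinal.ord_aleph, Cardinal.lt_ord, ← Order.lt_succ_iff, Cardinal.succ_aleph0]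

theorem exists_injective_range_eq_Iio {κ : Ordinal.{0}} (hω : ω ≤ κ) (h : κ < ω₁) :
    ∃ rk : ℕ → Ordinal.{0}, Function.Injective rk ∧ Set.range rk = Set.Iio κ := by
  have hc : Cardinal.mk (Set.Iio κ) = Cardinal.aleph0 := by
    rw [Cardinal.mk_Iio_ordinal, Cardinal.lift_eq_aleph0]
    exact le_antisymm (lt_omega_one_iff_card_le.1 h) (Ordinal.aleph0_le_card.2 hω)
  obtain ⟨_⟩ := Cardinal.denumerable_iff.2 hc
  exact ⟨fun n => (Denumerable.eqv (Set.Iio κ)).symm n,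
    Subtype.val_injective.comp (Equiv.injective _), by
      rw [Set.range_comp' Subtype.val]
      simp
      rfl⟩

theorem theorem1p1 :
    (∀ ξ : Ordinal.{0}, 1 ≤ ξ → ξ < ω₁ →
      ∃ f : BaireSp →. BaireSp,
        f.graphᶜ ∈ PiZero (BaireSp × BaireSp) 2 ∧
        f.graphᶜ ∈ RectSigma (BorelSets BaireSp) (SigmaZero BaireSp 1) ∧
        f.graphᶜ ∉ RectSigma (SigmaZero BaireSp ξ) (BorelSets BaireSp)) ∧
    (¬ ∃ r : Set.Ico (1 : Ordinal.{0}) ω₁ → Set.Ico (1 : Ordinal.{0}) ω₁,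
      ∀ ξ : Set.Ico (1 : Ordinal.{0}) ω₁,
        PiZero (BaireSp × BaireSp) ξ ∩ RectSigma (BorelSets BaireSp) (BorelSets BaireSp) ⊆
          RectSigma (PiZero BaireSp (r ξ)) (PiZero BaireSp (r ξ))) ∧
    (¬ ∃ s : Set.Ico (1 : Ordinal.{0}) ω₁ → Set.Ico (1 : Ordinal.{0}) ω₁,
      ∀ ξ : Set.Ico (1 : Ordinal.{0}) ω₁,
        PiZero (BaireSp × BaireSp) ξ ∩ RectSigma (BorelSets BaireSp) (SigmaZero BaireSp 1) ⊆
          RectSigma (PiZero BaireSp (s ξ)) (SigmaZero BaireSp 1)) := by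
  have main : ∀ ξ : Ordinal.{0}, 1 ≤ ξ → ξ < ω₁ →
      ∃ f : BaireSp →. BaireSp,
        f.graphᶜ ∈ PiZero (BaireSp × BaireSp) 2 ∧
        f.graphᶜ ∈ RectSigma (BorelSets BaireSp) (SigmaZero BaireSp 1) ∧
        f.graphᶜ ∉ RectSigma (SigmaZero BaireSp ξ) (BorelSets BaireSp) := by
    intro ξ h1 hξ
    -- `ω * ξ + 2` is the least bound that leaves room for both root labels `ω * ξ` and `ω * ξ + 1`.
    have hω : ω ≤ ω * ξ + 2 :=
      (Ordinal.le_mul_left _ (zero_lt_one.trans_le h1)).trans le_self_add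
    have hκ : ω * ξ + 2 < ω₁ := by
      rw [lt_omega_one_iff_card_le] at hξ ⊢
      rw [Ordinal.card_add, Ordinal.card_mul, Ordinal.card_omega0]
      refine Cardinal.add_le_aleph0.2 ⟨?_, ?_⟩
      · exact (mul_le_mul_right hξ _).trans_eq Cardinal.aleph0_mul_aleph0
      · simp
    obtain ⟨rk, hinj, hrk⟩ := exists_injective_range_eq_Iio hω hκ
    have h01 : ω * ξ < ω * ξ + 1 := Order.lt_add_one_iff.2 le_rfl
    have h12 : ω * ξ + 1 < ω * ξ + 2 := by simp
    obtain ⟨a, ha⟩ : ω * ξ ∈ Set.range rk := hrk ▸ h01.trans h12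
    obtain ⟨b, hb⟩ : ω * ξ + 1 ∈ Set.range rk := hrk ▸ h12
    have hab : a ≠ b := by
      rintro rfl
      exact h01.ne (ha.symm.trans hb)
    obtain ⟨f, hf⟩ := exists_pfun_graph_eq (G := decodingGraph rk a b)
      fun _ _ _ h h' => decodingGraph_unique hinj h h'
    refine ⟨f, ?_, ?_, ?_⟩ <;> rw [hf]
    · exact decodingGraph_compl_mem_piZero rk a b
    · exact decodingGraph_compl_mem_rectSigma hinj a b
    · exact decodingGraph_compl_notMem_rectSigma hinj hrk hab ha.ge (hb ▸ h01.le)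
  have sigma_one_borel : SigmaZero BaireSp 1 ⊆ BorelSets BaireSp :=
    fun _ h => h.measurableSet_borel
  have pi_sigma : ∀ {η : Ordinal.{0}}, 1 ≤ η → PiZero BaireSp η ⊆ SigmaZero BaireSp (η + 1) := by
    intro η hη A hA
    have h := IsSigmaZero.iUnion_compl (hη.trans_lt (Order.lt_add_one_iff.2 le_rfl)) (fun _ => η)
      (fun _ => Aᶜ) (fun _ => ⟨hη, Order.lt_add_one_iff.2 le_rfl⟩) (fun _ => hA)
    simp only [compl_compl, Set.iUnion_const] at h
    exact h
  have pi_borel : ∀ {η : Ordinal.{0}}, PiZero BaireSp η ⊆ BorelSets BaireSp := by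
    intro η A hA
    have := (IsSigmaZero.measurableSet_borel hA).compl
    rwa [compl_compl] at this
  have mono : ∀ {Γ₁ Γ₂ Γ₁' Γ₂' : Set (Set BaireSp)}, Γ₁ ⊆ Γ₂ → Γ₁' ⊆ Γ₂' →
      RectSigma Γ₁ Γ₁' ⊆ RectSigma Γ₂ Γ₂' :=
    fun h h' _ ⟨C, D, hC, hD, hA⟩ => ⟨C, D, fun n => h (hC n), fun n => h' (hD n), hA⟩
  have succ_lt : ∀ {η : Ordinal.{0}}, η < ω₁ → η + 1 < ω₁ := fun h =>
    by
    rw [← Cardinal.ord_aleph] at h ⊢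
    exact (Cardinal.isSuccLimit_ord (Cardinal.aleph0_le_aleph 1)).add_one_lt h
  let two : Set.Ico (1 : Ordinal.{0}) ω₁ := ⟨2, one_le_two,
    (Ordinal.natCast_lt_omega0 2).trans Ordinal.omega0_lt_omega_one⟩
  refine ⟨main, ?_, ?_⟩
  · rintro ⟨r, hr⟩
    obtain ⟨hr1, hr2⟩ := (r two).2
    -- The value at `2` already fails, since `Π⁰_η` is contained in `Σ⁰_{η+1}`.
    obtain ⟨f, hf2, hf, hfn⟩ := main (r two + 1) (hr1.trans le_self_add) (succ_lt hr2)
    exact hfn (mono (pi_sigma hr1) pi_borel (hr two ⟨hf2, mono subset_rfl sigma_one_borel hf⟩))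
  · rintro ⟨s, hs⟩
    obtain ⟨hs1, hs2⟩ := (s two).2
    obtain ⟨f, hf2, hf, hfn⟩ := main (s two + 1) (hs1.trans le_self_add) (succ_lt hs2)
    exact hfn (mono (pi_sigma hs1) sigma_one_borel (hs two ⟨hf2, hf⟩))
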